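/- \textbf{Setting.} Let $X$ and $Y$ be two leagues of $n$ teams each. For $x\in X$, $y\in Y$ write $x\to y$ for the game between $x$ and $y$ at the home of $y$, and $y\to x$ for the game at the home of $x$. A \emph{feasible schedule} for the bipartite traveling tournament problem (BTTP) assigns to each of $2n$ consecutive days a set of games between a team of $X$ and a team of $Y$ such that: every game $x\to y$ and every game $y\to x$ is played exactly once; every team plays exactly one game on each day; no two teams meet on two consecutive days (\emph{no-repeat}); and no team plays more than three consecutive home games or more than three consecutive away games (\emph{bounded-by-3}). \textbf{The 3-path construction.} Let $\varepsilon>0$, $d=6\lceil 1/\varepsilon\rceil$, $m=2\lfloor n/(6d)\rfloor-1$, $n_\varepsilon=3md$ and $l=n-n_\varepsilon$. For sets $X_\varepsilon\subseteq X$ and $Y_\varepsilon\subseteq Y$ of $n_\varepsilon$ teams each, let ordered packings of the complete graphs on $X_\varepsilon$ and $Y_\varepsilon$ by $md$ vertex-disjoint directed 3-paths $P_1,\dots,P_{md}$ and $Q_1,\dots,Q_{md}$ be given. Label the teams so that $P_i=x_{3i-3}x_{3i-2}x_{3i-1}$ and $Q_i=y_{3i-3}y_{3i-2}y_{3i-1}$,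 and label the remaining teams arbitrarily $x_{n_\varepsilon},\dots,x_{n-1}$ and $y_{n_\varepsilon},\dots,y_{n-1}$. For $1\le i\le m$ let the super-team $S_i$ consist of the teams $x_{3d(i-1)+k}$, and the super-team $T_i$ of the teams $y_{3d(i-1)+k}$, $0\le k<3d$; for $1\le p\le l$ let the team-pair $L_p$ be $\{x_{n_\varepsilon+p-1},y_{n_\varepsilon+p-1}\}$. A bar over a set of games, or over a sequence of such sets, reverses the venues of all its games. The schedule has $m$ time slots of $6d$ days each, followed by a last time slot of $2l$ days. In the time slot $\tau\in\{1,\dots,m\}$ there is, for each position $p\in\{1,\dots,m\}$, a super-game between $S_i$ and $T_j$, where $i\equiv p+\tau-1$ and $j\equiv p+2(\tau-1)\pmod m$. It is a left super-game, which also involves $L_p$, if $p\le l$, and a normal super-game otherwise. Write $s_k=x_{3d(i-1)+k}$ and $t_k=y_{3d(j-1)+k}$ for $0\le k<3d$. The super-games are extended to games on days $0,\dots,6d-1$ of the time slot as follows. \begin{itemize} \item Normal super-game: for $0\le a,b<d$ and $0\le a',b'\le 2$, the game $s_{3a+a'}\to t_{3b+b'}$ is on day $(6(a+b)+a'+b')\bmod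 6d$, and the game $t_{3b+b'}\to s_{3a+a'}$ is on day $(6(a+b)+a'+b'+3)\bmod 6d$. \item Left super-game: put $s_{3d}=x_{n_\varepsilon+p-1}$, $t_{3d}=y_{n_\varepsilon+p-1}$ and $m_c=\{s_k\to t_{(k+c)\bmod(3d+1)} : 0\le k\le 3d\}$. The sets of games of the $6d$ days are, in this order, $m_1\overline{m_2}m_3\overline{m_4}\cdots m_{3d-1}\overline{m_{3d}}\cdot\overline{\overline{m_2}m_3\overline{m_4}m_5\cdots\overline{m_{3d}}m_1}$. \end{itemize} In the last time slot let $A_c=\{x_{n_\varepsilon+k}\to y_{n_\varepsilon+((k+c)\bmod l)} : 0\le k<l\}$ for $0\le c<l$ and, for $1\le p\le l$, let $M_p$ be the set of the games $s_k\to t_k$, $0\le k<3d$, of all $m$ left super-games that involve $L_p$. The teams of the team-pairs play, on the $2l$ days, $A_0\overline{A_1}A_2\overline{A_3}\cdots$ ($l$ terms) followed by $\overline{A_0\overline{A_1}A_2\overline{A_3}\cdots}$; simultaneously, the teams of the super-teams play $M_1\overline{M_2}M_3\overline{M_4}\cdots$ ($l$ terms) followed by $\overline{M_1\overline{M_2}M_3\overline{M_4}\cdots}$.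 \textbf{Theorem 1.} If $n\ge 108d^3$, then for all such 3-path packings and labels the schedule on $2n$ days produced by the 3-path construction is feasible. -/

import Mathlib

namespace BTTP

/-- A game between two teams of the leagues `X` and `Y`, played at the home of `host`:
this is the game `visitor → host`. -/
@[ext]
structure Game (X Y : Type*) where
  visitor : X ⊕ Y
  host : X ⊕ Y

namespace Game

variable {X Y X' Y' : Type*}

/-- The same game with reversed venue. -/
def rev (g : Game X Y) : Game X Y := ⟨g.host, g.visitor⟩

/-- The team `v` takes part in the game `g`. -/
def Involves (g : Game X Y) (v : X ⊕ Y) : Prop := g.visitor = v ∨ g.host = v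

/-- Rename the teams of both leagues. -/
def map (f : X → X') (h : Y → Y') (g : Game X Y) : Game X' Y' :=
  ⟨Sum.map f h g.visitor, Sum.map f h g.host⟩

end Game

/-- A schedule on `D` days: the set of games of each day (days are `0, …, D - 1`). -/
abbrev Schedule (X Y : Type*) (D : ℕ) := Fin D → Set (Game X Y)

/-- Feasibility of a schedule on `2n` days for two leagues `X` and `Y`: it is a double round-robin
bipartite tournament that satisfies the no-repeat and the bounded-by-3 constraint. -/
structure IsFeasible {X Y : Type*} {n : ℕ} (S : Schedule X Y (2 * n)) : Prop where
  /-- only games between a team of `X` and a team of `Y` are played -/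
  bipartite : ∀ t, ∀ g ∈ S t, g.visitor.isLeft ≠ g.host.isLeft
  /-- each of the two games between `x` and `y` is played exactly once -/
  once_at_y : ∀ (x : X) (y : Y), ∃! t, (⟨Sum.inl x, Sum.inr y⟩ : Game X Y) ∈ S t
  once_at_x : ∀ (x : X) (y : Y), ∃! t, (⟨Sum.inr y, Sum.inl x⟩ : Game X Y) ∈ S t
  /-- every team plays exactly one game on every day -/
  one_per_day : ∀ t (v : X ⊕ Y), ∃! g, g ∈ S t ∧ g.Involves v
  /-- no two teams meet on two consecutive days -/
  no_repeat : ∀ t t' : Fin (2 * n), t.val + 1 = t'.val →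
    ∀ g ∈ S t, ∀ g' ∈ S t', g' ≠ g ∧ g' ≠ g.rev
  /-- no team plays four consecutive home games -/
  home_bounded : ∀ (v : X ⊕ Y) (t : ℕ) (ht : t + 3 < 2 * n),
    ¬ ∀ k : Fin 4, ∃ g ∈ S ⟨t + k.val, by omega⟩, g.host = v
  /-- no team plays four consecutive away games -/
  away_bounded : ∀ (v : X ⊕ Y) (t : ℕ) (ht : t + 3 < 2 * n),
    ¬ ∀ k : Fin 4, ∃ g ∈ S ⟨t + k.val, by omega⟩, g.visitor = v

/-! ### Parameters -/

/-- `d = 6 ⌈1/ε⌉`, the number of 3-paths of a super-team. -/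
noncomputable def pathsPerTeam (ε : ℝ) : ℕ := 6 * ⌈1 / ε⌉₊

/-- `m = 2 ⌊n / (6d)⌋ - 1`, the number of super-teams of a league. -/
def numSuper (n d : ℕ) : ℕ := 2 * (n / (6 * d)) - 1

/-- `l = n - 3md`, the number of team-pairs. -/
def numPairs (n d : ℕ) : ℕ := n - 3 * numSuper n d * d

/-! ### 3-path packings and labels -/

/-- An ordered packing of `N` vertex-disjoint (directed) 3-paths in the complete graph on the
league `V`, together with an enumeration of the `l` teams that are not on these paths.
The `i`-th path is `path i 0, path i 1, path i 2` (`i` counted from `0`). -/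
structure LabelledPacking (V : Type*) (N l : ℕ) where
  path : Fin N → Fin 3 → V
  rest : Fin l → V
  /-- all listed vertices are distinct, and every team of the league is listed -/
  bijective : Function.Bijective
    (Sum.elim (fun q : Fin N × Fin 3 => path q.1 q.2) rest)

/-- The label of a team: the `i`-th path is labelled `3i, 3i+1, 3i+2` along the path, and
the remaining teams are labelled `3N, 3N+1, …`. -/
noncomputable def LabelledPacking.label {V : Type*} {N l : ℕ} (P : LabelledPacking V N l)
    (v : V) : ℕ :=
  match (Equiv.ofBijective _ P.bijective).symm v with
  | Sum.inl q => 3 * q.1.val + q.2.val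
  | Sum.inr j => 3 * N + j.val

/-! ### The construction on labels

Teams are represented by their labels: `Sum.inl a` is the team `x_a`, `Sum.inr b` is `y_b`.
Super-teams `S_i`, `T_j`, positions (hence team-pairs) and time slots are counted from `0`.  -/

/-- A set of games between labelled teams. -/
abbrev Games := Set (Game ℕ ℕ)

/-- The game `x_a → y_b`. -/
def go (a b : ℕ) : Game ℕ ℕ := ⟨Sum.inl a, Sum.inr b⟩

/-- The same games with reversed venues. -/
def bar (M : Games) : Games := {g | g.rev ∈ M}

open Classical in
/-- `bar M` if `c` holds, and `M` otherwise. -/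
noncomputable def barIf (c : Prop) (M : Games) : Games := if c then bar M else M

/-- The games `{s_a → t_{(a + i) mod k} | 0 ≤ a < k}`, where `s_a`, `t_b` are the teams of `X`
and `Y` with labels `s a` and `t b`. -/
def rotation (k : ℕ) (s t : ℕ → ℕ) (i : ℕ) : Games :=
  {g | ∃ a < k, g = go (s a) (t ((a + i) % k))}

/-- Label of the `k`-th team, `k < 3d`, of the `i`-th super-team of either league. -/
def member (d i k : ℕ) : ℕ := 3 * d * i + k

/-- Games on day `r < 6d` of a normal super-game between `S_i` and `T_j`. -/
def normalDay (d i j r : ℕ) : Games :=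
  {g | ∃ a < d, ∃ b < d, ∃ a' < 3, ∃ b' < 3,
    (r = (6 * (a + b) + a' + b') % (6 * d) ∧
      g = go (member d i (3 * a + a')) (member d j (3 * b + b'))) ∨
    (r = (6 * (a + b) + a' + b' + 3) % (6 * d) ∧
      g = (go (member d i (3 * a + a')) (member d j (3 * b + b'))).rev)}

/-- Label of the `k`-th team, `k ≤ 3d`, among the teams of one league in a left super-game:
the teams of the `i`-th super-team, followed by the team of the `p`-th team-pair. -/
def leftMember (d m p i k : ℕ) : ℕ := if k < 3 * d then member d i k else 3 * m * d + p

/-- The games `m_c` of the left super-game between `S_i` and `T_j` with the `p`-th team-pair. -/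
def leftRot (d m p i j c : ℕ) : Games :=
  rotation (3 * d + 1) (leftMember d m p i) (leftMember d m p j) c

/-- Games on day `r < 6d` of the left super-game between `S_i` and `T_j` with the `p`-th team-pair
(for even `d`): with overlines for reversed venues, the sequence
`m_1 \bar m_2 m_3 \bar m_4 ⋯ m_{3d-1} \bar m_{3d}` is followed by the venue reversal of
`\bar m_2 m_3 \bar m_4 m_5 ⋯ \bar m_{3d} m_1`. -/
noncomputable def leftDay (d m p i j r : ℕ) : Games :=
  if r < 3 * d then
    barIf (Odd r) (leftRot d m p i j (r + 1))
  else
    bar (barIf (Even (r - 3 * d))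
      (leftRot d m p i j (if r - 3 * d + 1 < 3 * d then r - 3 * d + 2 else 1)))

/-- In the time slot `τ`, the super-team of `X` at position `p` is `S_{(p + τ) mod m}`. -/
def superX (m τ p : ℕ) : ℕ := (p + τ) % m

/-- In the time slot `τ`, the super-team of `Y` at position `p` is `T_{(p + 2τ) mod m}`. -/
def superY (m τ p : ℕ) : ℕ := (p + 2 * τ) % m

/-- Games on day `r < 6d` of the time slot `τ < m`: the super-games at the positions `p < l`
are left super-games, the other ones are normal. -/
noncomputable def slotDay (d m l τ r : ℕ) : Games :=
  {g | ∃ p < m, g ∈ if p < l then leftDay d m p (superX m τ p) (superY m τ p) r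
    else normalDay d (superX m τ p) (superY m τ p) r}

/-- The games `x_a → y_b` between super-teams that were left out in the left super-games with the
`p`-th team-pair. -/
def leftOut (d m p : ℕ) : Games :=
  {g | ∃ τ < m, ∃ k < 3 * d,
    g = go (member d (superX m τ p) k) (member d (superY m τ p) k)}

/-- For sets of games `A_0, …, A_{l-1}`, the games on day `r < 2l` of the sequence
`A_0 \bar A_1 A_2 \bar A_3 ⋯` (`l` terms) followed by the venue reversal of this sequence. -/
noncomputable def alternate (l : ℕ) (A : ℕ → Games) (r : ℕ) : Games :=
  if r < l then barIf (Odd r) (A r) else bar (barIf (Odd (r - l)) (A (r - l)))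

/-- Games on day `r < 2l` of the last time slot: those between teams of team-pairs, and those
between teams of super-teams. -/
noncomputable def lastDay (d m l r : ℕ) : Games :=
  alternate l (rotation l (fun k => 3 * m * d + k) (fun k => 3 * m * d + k)) r ∪
    alternate l (leftOut d m) r

/-- Games on day `t < 6md + 2l` of the whole construction: `m` time slots of `6d` days each, and
a last time slot of `2l` days. -/
noncomputable def labelDay (d m l t : ℕ) : Games :=
  if t < 6 * m * d then slotDay d m l (t / (6 * d)) (t % (6 * d))
  else lastDay d m l (t - 6 * m * d)

/-- The schedule on `2n` days that the 3-path construction produces from 3-path packings with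
`md` paths in both leagues. -/
noncomputable def threePathSchedule {X Y : Type*} (n d : ℕ)
    (P : LabelledPacking X (numSuper n d * d) (numPairs n d))
    (Q : LabelledPacking Y (numSuper n d * d) (numPairs n d)) : Schedule X Y (2 * n) :=
  fun t => {g | g.map P.label Q.label ∈ labelDay d (numSuper n d) (numPairs n d) t.val}

end BTTP

/-! A game is a triple (venue, team of $X$, team of $Y$), so a team has $2n$ games to play on $2n$
days. Hence it suffices to show that every game occurs on some day (`exists_day`) and that no team
has two games on one day (`right_unique`, `left_unique`). Counting (`bijective_relation`) then gives
that each game occurs exactly once and each team plays on every day.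

Existence and uniqueness are checked on addresses (slot, position, index within the super-team). The
pair $(p+\tau,\,p+2\tau)$ modulo $m$ determines $\tau$ as the difference and then $p$, so any two
super-teams share exactly one super-game. As $m$ is odd, each super-team of either league visits
each position exactly once, hence meets each team-pair once. A left super-game uses every shift
except $0$; the missing games fill the last slot.

No-repeat: inside a super-game, two given teams meet on days that agree modulo 3 (normal) or have
different shifts on successive days (left). Two teams that meet in one slot do not meet in the next,
and the games on the first day of the last slot are of shift $0$.

Bounded-by-3: the venue depends only on the day, the label modulo 3 and whether the current
super-game is left (`Pattern`). All slots start at multiples of 6, so the claim reduces to a finite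
check modulo 6 (`pattern_not_const`). -/

namespace BTTP

/-! ### Games as triples of a venue and two teams -/

section Fixtures

variable {X Y X' Y' : Type*}

/-- The game between `x` and `y` at the home of `x` if `h` is true, at the home of `y` otherwise. -/
def fixture : Bool → X → Y → Game X Y
  | true, x, y => ⟨Sum.inr y, Sum.inl x⟩
  | false, x, y => ⟨Sum.inl x, Sum.inr y⟩

theorem fixture_inj {h h' : Bool} {x x' : X} {y y' : Y} :
    fixture h x y = fixture h' x' y' ↔ h = h' ∧ x = x' ∧ y = y' := by
  cases h <;> cases h' <;> simp [fixture, Game.ext_iff, and_comm]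

theorem fixture_rev (h : Bool) (x : X) (y : Y) : (fixture h x y).rev = fixture (!h) x y := by
  cases h <;> rfl

theorem fixture_map (f : X → X') (f' : Y → Y') (h : Bool) (x : X) (y : Y) :
    (fixture h x y).map f f' = fixture h (f x) (f' y) := by
  cases h <;> rfl

theorem involves_inl {h : Bool} {x x' : X} {y : Y} :
    (fixture h x y).Involves (Sum.inl x') ↔ x = x' := by
  cases h <;> simp [fixture, Game.Involves]

theorem involves_inr {h : Bool} {x : X} {y y' : Y} :
    (fixture h x y).Involves (Sum.inr y') ↔ y = y' := by
  cases h <;> simp [fixture, Game.Involves]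

theorem exists_fixture_of_map {f : X → X'} {f' : Y → Y'} {g : Game X Y} {h : Bool} {a : X'} {b : Y'}
    (hg : g.map f f' = fixture h a b) : ∃ x y, g = fixture h x y := by
  obtain ⟨v, w⟩ := g
  cases h <;> rcases v with v | v <;> rcases w with w | w <;>
    simp [fixture, Game.map] at hg <;> exact ⟨_, _, rfl⟩

theorem go_eq_fixture (a b : ℕ) : go a b = fixture false a b := rfl

theorem go_rev_eq_fixture (a b : ℕ) : (go a b).rev = fixture true a b := rfl

end Fixtures

/-! ### Membership in the building blocks of the schedule -/

/-- All games of `M` are played at the home of the team of `Y`. -/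
def OneVenue (M : Games) : Prop := ∀ g ∈ M, ∃ a b, g = go a b

theorem OneVenue.mem_barIf {M : Games} (hM : OneVenue M) {c : Prop} {g : Game ℕ ℕ} :
    g ∈ barIf c M ↔ ∃ h a b, g = fixture h a b ∧ (h = true ↔ c) ∧ go a b ∈ M := by
  unfold barIf
  split_ifs with hc
  · constructor
    · intro hg
      obtain ⟨a, b, h⟩ := hM _ hg
      refine ⟨true, a, b, ?_, by simp [hc], h ▸ hg⟩
      rw [← go_rev_eq_fixture, ← h]
      rfl
    · rintro ⟨h, a, b, rfl, hh, hab⟩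
      obtain rfl : h = true := hh.2 hc
      exact hab
  · constructor
    · intro hg
      obtain ⟨a, b, h⟩ := hM _ hg
      exact ⟨false, a, b, h, by simp [hc], h ▸ hg⟩
    · rintro ⟨h, a, b, rfl, hh, hab⟩
      obtain rfl : h = false := by simpa [hc] using hh
      exact hab

theorem bar_bar (M : Games) : bar (bar M) = M := rfl

theorem bar_barIf (c : Prop) (M : Games) : bar (barIf c M) = barIf (¬ c) M := by
  unfold barIf
  by_cases hc : c <;> simp [hc, bar_bar]

theorem oneVenue_rotation (k : ℕ) (s t : ℕ → ℕ) (i : ℕ) : OneVenue (rotation k s t i) := by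
  rintro g ⟨a, -, rfl⟩
  exact ⟨_, _, rfl⟩

theorem oneVenue_leftOut (d m p : ℕ) : OneVenue (leftOut d m p) := by
  rintro g ⟨τ, -, k, -, rfl⟩
  exact ⟨_, _, rfl⟩

theorem go_mem_rotation {k : ℕ} {s t : ℕ → ℕ} {i a b : ℕ} :
    go a b ∈ rotation k s t i ↔ ∃ e < k, a = s e ∧ b = t ((e + i) % k) := by
  simp [rotation, go_eq_fixture, fixture_inj]

theorem go_mem_leftOut {d m p a b : ℕ} :
    go a b ∈ leftOut d m p ↔ ∃ τ < m, ∃ k < 3 * d,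
      a = member d (superX m τ p) k ∧ b = member d (superY m τ p) k := by
  simp [leftOut, go_eq_fixture, fixture_inj]

/-- The rotation `c` such that the games of `m_c` are played, at one of the two venues, on day `r`
of a left super-game. -/
def leftShift (d r : ℕ) : ℕ :=
  if r < 3 * d then r + 1 else if r + 1 < 6 * d then r - 3 * d + 2 else 1

/-- Since $3d$ is even, the second half, which starts with a doubly reversed $m_2$, continues the
alternation of the first half: venues alternate throughout the slot. -/
theorem leftDay_eq {d : ℕ} (hd : Even d) (m p i j : ℕ) {r : ℕ} (hr : r < 6 * d) :
    leftDay d m p i j r = barIf (Odd r) (leftRot d m p i j (leftShift d r)) := by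
  obtain ⟨e, rfl⟩ := hd
  unfold leftDay leftShift
  split_ifs <;> first | rfl | omega | skip
  all_goals
    rw [bar_barIf]
    congr 1
    rw [Nat.even_iff, Nat.odd_iff, eq_iff_iff]
    omega

theorem alternate_eq (l : ℕ) (A : ℕ → Games) (r : ℕ) :
    alternate l A r =
      barIf (if r < l then Odd r else Even (r - l)) (A (if r < l then r else r - l)) := by
  unfold alternate
  split_ifs
  · rfl
  · rw [bar_barIf, Nat.not_odd_iff_even]

theorem mem_normalDay {d i j r : ℕ} {g : Game ℕ ℕ} :
    g ∈ normalDay d i j r ↔ ∃ h, ∃ u < d, ∃ u' < 3, ∃ v < d, ∃ v' < 3,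
      g = fixture h (member d i (3 * u + u')) (member d j (3 * v + v')) ∧
      r = (6 * (u + v) + u' + v' + if h = true then 3 else 0) % (6 * d) := by
  constructor
  · rintro ⟨u, hu, v, hv, u', hu', v', hv', ⟨hr, rfl⟩ | ⟨hr, rfl⟩⟩
    · exact ⟨false, u, hu, u', hu', v, hv, v', hv', rfl, by simpa using hr⟩
    · exact ⟨true, u, hu, u', hu', v, hv, v', hv', rfl, by simpa using hr⟩
  · rintro ⟨h, u, hu, u', hu', v, hv, v', hv', rfl, hr⟩
    refine ⟨u, hu, v, hv, u', hu', v', hv', ?_⟩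
    cases h
    · exact .inl ⟨by simpa using hr, rfl⟩
    · exact .inr ⟨by simpa using hr, rfl⟩

/-- On day `r` of a super-game at position `p`, which is a left super-game if `p < l`, the `e`-th
team of `X` meets the `e'`-th team of `Y`, at the home of the former if and only if `h` is true. -/
def Meets (d l p r : ℕ) (h : Bool) (e e' : ℕ) : Prop :=
  (p < l ∧ e < 3 * d + 1 ∧ (h = true ↔ Odd r) ∧ e' = (e + leftShift d r) % (3 * d + 1)) ∨
  (l ≤ p ∧ ∃ u < d, ∃ u' < 3, ∃ v < d, ∃ v' < 3, e = 3 * u + u' ∧ e' = 3 * v + v' ∧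
    r = (6 * (u + v) + u' + v' + if h = true then 3 else 0) % (6 * d))

theorem leftMember_of_lt {d k : ℕ} (hk : k < 3 * d) (m p i : ℕ) :
    leftMember d m p i k = member d i k := if_pos hk

/-- The games of a day of a time slot. -/
theorem mem_slotDay {d : ℕ} (hd : Even d) {m l τ r : ℕ} (hr : r < 6 * d) {g : Game ℕ ℕ} :
    g ∈ slotDay d m l τ r ↔ ∃ h, ∃ p < m, ∃ e e', Meets d l p r h e e' ∧
      g = fixture h (leftMember d m p (superX m τ p) e) (leftMember d m p (superY m τ p) e') := by
  constructor
  · rintro ⟨p, hp, hg⟩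
    split_ifs at hg with hpl
    · rw [leftDay_eq hd _ _ _ _ hr, leftRot, (oneVenue_rotation _ _ _ _).mem_barIf] at hg
      obtain ⟨h, a, b, rfl, hh, hab⟩ := hg
      obtain ⟨k, hk, rfl, rfl⟩ := go_mem_rotation.1 hab
      exact ⟨h, p, hp, k, _, .inl ⟨hpl, hk, hh, rfl⟩, rfl⟩
    · obtain ⟨h, u, hu, u', hu', v, hv, v', hv', rfl, hr⟩ := mem_normalDay.1 hg
      refine ⟨h, p, hp, _, _,
        .inr ⟨by omega, u, hu, u', hu', v, hv, v', hv', rfl, rfl, hr⟩, ?_⟩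
      rw [leftMember_of_lt (by omega), leftMember_of_lt (by omega)]
  · rintro ⟨h, p, hp, e, e', ⟨hpl, he, hh, rfl⟩ |
      ⟨hpl, u, hu, u', hu', v, hv, v', hv', rfl, rfl, hr⟩, rfl⟩
    · refine ⟨p, hp, ?_⟩
      rw [if_pos hpl, leftDay_eq hd _ _ _ _ hr, leftRot, (oneVenue_rotation _ _ _ _).mem_barIf]
      exact ⟨h, _, _, rfl, hh, go_mem_rotation.2 ⟨e, he, rfl, rfl⟩⟩
    · refine ⟨p, hp, ?_⟩
      rw [if_neg (by omega), leftMember_of_lt (by omega), leftMember_of_lt (by omega)]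
      exact mem_normalDay.2 ⟨h, u, hu, u', hu', v, hv, v', hv', rfl, hr⟩

/-- The games of a day of the last time slot. -/
theorem mem_lastDay {d m l r : ℕ} {g : Game ℕ ℕ} :
    g ∈ lastDay d m l r ↔ ∃ h : Bool, (h = true ↔ if r < l then Odd r else Even (r - l)) ∧
      ((∃ k < l, g = fixture h (3 * m * d + k)
        (3 * m * d + (k + if r < l then r else r - l) % l)) ∨
      ∃ τ < m, ∃ k < 3 * d,
        g = fixture h (member d (superX m τ (if r < l then r else r - l)) k)
          (member d (superY m τ (if r < l then r else r - l)) k)) := by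
  rw [lastDay, Set.mem_union, alternate_eq, alternate_eq, (oneVenue_rotation _ _ _ _).mem_barIf,
    (oneVenue_leftOut _ _ _).mem_barIf]
  constructor
  · rintro (⟨h, a, b, rfl, hh, hab⟩ | ⟨h, a, b, rfl, hh, hab⟩)
    · obtain ⟨k, hk, rfl, rfl⟩ := go_mem_rotation.1 hab
      exact ⟨h, hh, .inl ⟨k, hk, rfl⟩⟩
    · obtain ⟨τ, hτ, k, hk, rfl, rfl⟩ := go_mem_leftOut.1 hab
      exact ⟨h, hh, .inr ⟨τ, hτ, k, hk, rfl⟩⟩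
  · rintro ⟨h, hh, ⟨k, hk, rfl⟩ | ⟨τ, hτ, k, hk, rfl⟩⟩
    · exact .inl ⟨h, _, _, rfl, hh, go_mem_rotation.2 ⟨k, hk, rfl, rfl⟩⟩
    · exact .inr ⟨h, _, _, rfl, hh, go_mem_leftOut.2 ⟨τ, hτ, k, hk, rfl, rfl⟩⟩

theorem exists_fixture_of_mem_labelDay {d : ℕ} (hd : Even d) (hd0 : 0 < d) {m l t : ℕ}
    {g : Game ℕ ℕ} (hg : g ∈ labelDay d m l t) : ∃ h a b, g = fixture h a b := by
  unfold labelDay at hg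
  split_ifs at hg
  · obtain ⟨h, p, -, e, e', -, rfl⟩ := (mem_slotDay hd (Nat.mod_lt _ (by omega))).1 hg
    exact ⟨_, _, _, rfl⟩
  · obtain ⟨h, -, ⟨k, -, rfl⟩ | ⟨τ, -, k, -, rfl⟩⟩ := mem_lastDay.1 hg
    · exact ⟨_, _, _, rfl⟩
    · exact ⟨_, _, _, rfl⟩

/-! ### Meetings within a super-game -/

/-- Turns a residue modulo a variable into linear arithmetic; used for positions, shifts and
rotations alike. -/
theorem add_mod_cases {k c K : ℕ} (hk : k < K) (hc : c ≤ K) :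
    (k + c < K ∧ (k + c) % K = k + c) ∨ (K ≤ k + c ∧ (k + c) % K = k + c - K) := by
  rcases lt_or_ge (k + c) K with h | h
  · exact .inl ⟨h, Nat.mod_eq_of_lt h⟩
  · exact .inr ⟨h, by rw [Nat.mod_eq_sub_mod h, Nat.mod_eq_of_lt (by omega)]⟩

theorem leftShift_pos (d r : ℕ) : 0 < leftShift d r := by
  unfold leftShift; split_ifs <;> omega

theorem leftShift_le {d : ℕ} (hd : 0 < d) (r : ℕ) : leftShift d r ≤ 3 * d := by
  unfold leftShift; split_ifs <;> omega

theorem leftShift_succ_ne {d r : ℕ} (hr : r + 1 < 6 * d) :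
    leftShift d (r + 1) ≠ leftShift d r := by
  unfold leftShift; split_ifs <;> omega

/-- The shift $c$ is used on day $c-1$ and again on day $3d+c-2$ (day $6d-1$ if $c=1$). These days
have opposite parity, so both venues occur. -/
theorem exists_leftShift_eq {d : ℕ} (hd : Even d) {c : ℕ} (hc : 0 < c) (hcd : c ≤ 3 * d)
    (h : Bool) : ∃ r < 6 * d, leftShift d r = c ∧ (h = true ↔ Odd r) := by
  obtain ⟨e, rfl⟩ := hd
  have key : ∀ r, r < 6 * (e + e) → leftShift (e + e) r = c → (h = true ↔ r % 2 = 1) →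
      ∃ r < 6 * (e + e), leftShift (e + e) r = c ∧ (h = true ↔ Odd r) := fun r h₁ h₂ h₃ =>
    ⟨r, h₁, h₂, by rwa [Nat.odd_iff]⟩
  by_cases hp : (h = true ↔ c % 2 = 0)
  · refine key (c - 1) (by omega) (by unfold leftShift; split_ifs <;> omega) ?_
    rw [hp]; omega
  · have hp' : (h = true ↔ c % 2 = 1) := by
      cases h <;> simp at hp ⊢ <;> omega
    by_cases h1 : c = 1
    · refine key (6 * (e + e) - 1) (by omega) (by unfold leftShift; split_ifs <;> omega) ?_
      rw [hp']; omega
    · refine key (3 * (e + e) + c - 2) (by omega) (by unfold leftShift; split_ifs <;> omega) ?_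
      rw [hp']; omega

theorem mod_six_mul_cases {d u v w : ℕ} (hu : u < d) (hv : v < d) (hw : w < 8) :
    (6 * (u + v) + w) % (6 * d) = 6 * (u + v) + w ∨
    (6 * (u + v) + w) % (6 * d) + 6 * d = 6 * (u + v) + w := by
  rcases lt_or_ge (6 * (u + v) + w) (6 * d) with h | h
  · exact .inl (Nat.mod_eq_of_lt h)
  · right
    rw [Nat.mod_eq_sub_mod h, Nat.mod_eq_of_lt (by omega)]
    omega

namespace Meets

variable {d l p r : ℕ} {h h₁ : Bool} {e e₁ e' e₁' : ℕ}

theorem normal_cases (H : Meets d l p r h e e') (hp : l ≤ p) :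
    ∃ u < d, ∃ u' < 3, ∃ v < d, ∃ v' < 3, e = 3 * u + u' ∧ e' = 3 * v + v' ∧ ∃ c,
      (h = true ∧ c = 3 ∨ h = false ∧ c = 0) ∧ r < 6 * d ∧
      (r = 6 * (u + v) + u' + v' + c ∨ r + 6 * d = 6 * (u + v) + u' + v' + c) := by
  rcases H with ⟨hpl, -⟩ | ⟨-, u, hu, u', hu', v, hv, v', hv', h₁, h₂, hr⟩
  · omega
  refine ⟨u, hu, u', hu', v, hv, v', hv', h₁, h₂, if h = true then 3 else 0, by cases h <;> simp,
    hr ▸ Nat.mod_lt _ (by omega), ?_⟩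
  -- At most $2+2+3$, so the day number before reduction is below $12d$ and $6d$ is subtracted at
  -- most once.
  have hw : u' + v' + (if h = true then 3 else 0) < 8 := by split_ifs <;> omega
  have := mod_six_mul_cases hu hv hw
  rw [show 6 * (u + v) + (u' + v' + (if h = true then 3 else 0)) =
    6 * (u + v) + u' + v' + (if h = true then 3 else 0) by ring, ← hr] at this
  exact this

theorem left_cases (H : Meets d l p r h e e') (hp : p < l) (hd : 0 < d) :
    e ≤ 3 * d ∧ e' ≤ 3 * d ∧ (h = true ↔ r % 2 = 1) ∧
      (e' = e + leftShift d r ∨ e' + (3 * d + 1) = e + leftShift d r) := by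
  rcases H with ⟨-, he, hh, he'⟩ | ⟨hpl, -⟩
  · have := add_mod_cases he (Nat.le_succ_of_le (leftShift_le hd r))
    rw [Nat.odd_iff] at hh
    have hlt : e' < 3 * d + 1 := he' ▸ Nat.mod_lt _ (by omega)
    refine ⟨by omega, by omega, hh, by omega⟩
  · omega

theorem left_le (H : Meets d l p r h e e') (hd : 0 < d) : e < 3 * d ∨ e = 3 * d ∧ p < l := by
  rcases lt_or_ge p l with hp | hp
  · have := H.left_cases hp hd; omega
  · obtain ⟨u, hu, u', hu', v, hv, v', hv', h₁, h₂, -⟩ := H.normal_cases hp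
    omega

theorem right_le (H : Meets d l p r h e e') (hd : 0 < d) : e' < 3 * d ∨ e' = 3 * d ∧ p < l := by
  rcases lt_or_ge p l with hp | hp
  · have := H.left_cases hp hd; omega
  · obtain ⟨u, hu, u', hu', v, hv, v', hv', h₁, h₂, -⟩ := H.normal_cases hp
    omega

/-- The shift lies between $1$ and $3d$, so it is nonzero modulo $3d+1$. -/
theorem ne (H : Meets d l p r h e e') (hp : p < l) (hd : 0 < d) : e ≠ e' := by
  have := H.left_cases hp hd
  have := leftShift_pos d r
  have := leftShift_le hd r
  omega

/-- The opponent does not matter: in a normal super-game, the three teams of an opposing path are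
visited on days congruent to $u', u'+1, u'+2$ modulo 6 and received three days later, where $u'$ is
the index of the team modulo 3. -/
theorem venue_left (H : Meets d l p r h e e') (hd : 0 < d) :
    h = true ↔ if p < l then r % 2 = 1 else 3 ≤ (r + 6 - e % 3) % 6 := by
  rcases lt_or_ge p l with hp | hp
  · rw [if_pos hp]
    exact (H.left_cases hp hd).2.2.1
  · rw [if_neg (by omega)]
    obtain ⟨u, hu, u', hu', v, hv, v', hv', rfl, rfl, c, ⟨rfl, rfl⟩ | ⟨rfl, rfl⟩, hr⟩ :=
      H.normal_cases hp
    · simp only [true_iff]; omega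
    · simp only [Bool.false_eq_true, false_iff]; omega

theorem venue_right (H : Meets d l p r h e e') (hd : 0 < d) :
    h = true ↔ if p < l then r % 2 = 1 else 3 ≤ (r + 6 - e' % 3) % 6 := by
  rcases lt_or_ge p l with hp | hp
  · rw [if_pos hp]
    exact (H.left_cases hp hd).2.2.1
  · rw [if_neg (by omega)]
    obtain ⟨u, hu, u', hu', v, hv, v', hv', rfl, rfl, c, ⟨rfl, rfl⟩ | ⟨rfl, rfl⟩, hr⟩ :=
      H.normal_cases hp
    · simp only [true_iff]; omega
    · simp only [Bool.false_eq_true, false_iff]; omega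

theorem right_unique (H : Meets d l p r h e e') (H₁ : Meets d l p r h₁ e e₁') (hd : 0 < d) :
    h = h₁ ∧ e' = e₁' := by
  have hh : h = h₁ := by
    rw [Bool.eq_iff_iff, H.venue_left hd, H₁.venue_left hd]
  refine ⟨hh, ?_⟩
  rcases lt_or_ge p l with hp | hp
  · have := H.left_cases hp hd
    have := H₁.left_cases hp hd
    omega
  · obtain ⟨u, hu, u', hu', v, hv, v', hv', h₁, h₂, c, hc, hr⟩ := H.normal_cases hp
    obtain ⟨u₁, hu₁, u₁', hu₁', v₁, hv₁, v₁', hv₁', h₃, h₄, c₁, hc₁, hr₁⟩ := H₁.normal_cases hp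
    subst hh
    obtain rfl : c = c₁ := by grind
    -- The index $e$ fixes $u$ and $u'$; then $r$ modulo 6 gives $v'$, and $r$ modulo $6d$ gives
    -- $v$.
    obtain rfl : u = u₁ := by omega
    obtain rfl : u' = u₁' := by omega
    obtain rfl : v' = v₁' := by omega
    omega

theorem left_unique (H : Meets d l p r h e e') (H₁ : Meets d l p r h₁ e₁ e') (hd : 0 < d) :
    h = h₁ ∧ e = e₁ := by
  have hh : h = h₁ := by
    rw [Bool.eq_iff_iff, H.venue_right hd, H₁.venue_right hd]
  refine ⟨hh, ?_⟩
  rcases lt_or_ge p l with hp | hp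
  · have := H.left_cases hp hd
    have := H₁.left_cases hp hd
    omega
  · obtain ⟨u, hu, u', hu', v, hv, v', hv', h₁, h₂, c, hc, hr⟩ := H.normal_cases hp
    obtain ⟨u₁, hu₁, u₁', hu₁', v₁, hv₁, v₁', hv₁', h₃, h₄, c₁, hc₁, hr₁⟩ := H₁.normal_cases hp
    subst hh
    obtain rfl : c = c₁ := by grind
    obtain rfl : v = v₁ := by omega
    obtain rfl : v' = v₁' := by omega
    obtain rfl : u' = u₁' := by omega
    omega

theorem not_succ (H : Meets d l p r h e e') (hd : 0 < d) (hr : r + 1 < 6 * d) :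
    ¬ Meets d l p (r + 1) h₁ e e' := by
  intro H₁
  rcases lt_or_ge p l with hp | hp
  · have := H.left_cases hp hd
    have := H₁.left_cases hp hd
    have := leftShift_succ_ne hr
    have := leftShift_pos d r
    have := leftShift_le hd r
    have := leftShift_pos d (r + 1)
    have := leftShift_le hd (r + 1)
    omega
  · obtain ⟨u, hu, u', hu', v, hv, v', hv', h₁, h₂, c, hc, hr⟩ := H.normal_cases hp
    obtain ⟨u₁, hu₁, u₁', hu₁', v₁, hv₁, v₁', hv₁', h₃, h₄, c₁, hc₁, hr₁⟩ := H₁.normal_cases hp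
    -- The venue term and the modulus $6d$ are divisible by 3, so all days on which these two teams
    -- meet are congruent to $u'+v'$ modulo 3.
    have : c % 3 = 0 := by omega
    have : c₁ % 3 = 0 := by omega
    omega

end Meets

theorem exists_meets_left {d l p e e' : ℕ} (hd : Even d) (hp : p < l) (he : e ≤ 3 * d)
    (he' : e' ≤ 3 * d) (hne : e ≠ e') (h : Bool) : ∃ r < 6 * d, Meets d l p r h e e' := by
  obtain ⟨c, hc0, hc, hce⟩ : ∃ c, 0 < c ∧ c ≤ 3 * d ∧ e' = (e + c) % (3 * d + 1) := by
    rcases lt_or_ge e e' with hlt | hle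
    · exact ⟨e' - e, by omega, by omega, by rw [Nat.mod_eq_of_lt (by omega)]; omega⟩
    · refine ⟨e' + (3 * d + 1) - e, by omega, by omega, ?_⟩
      rcases add_mod_cases (k := e) (c := e' + (3 * d + 1) - e) (K := 3 * d + 1)
        (by omega) (by omega) with h | h <;> omega
  obtain ⟨r, hr, rfl, hh⟩ := exists_leftShift_eq hd hc0 hc h
  exact ⟨r, hr, .inl ⟨hp, by omega, hh, hce⟩⟩

theorem exists_meets_normal {d l p e e' : ℕ} (hp : l ≤ p) (he : e < 3 * d)
    (he' : e' < 3 * d) (h : Bool) : ∃ r < 6 * d, Meets d l p r h e e' :=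
  ⟨_, Nat.mod_lt _ (by omega), .inr ⟨hp, e / 3, by omega, e % 3, by omega, e' / 3, by omega,
    e' % 3, by omega, by omega, by omega, rfl⟩⟩

/-! ### Positions of super-teams -/

section Positions

variable {m τ τ' p p' : ℕ}

theorem superX_cases (hp : p < m) (hτ : τ < m) :
    superX m τ p < m ∧ (superX m τ p = p + τ ∨ superX m τ p + m = p + τ) := by
  have := add_mod_cases hp hτ.le
  unfold superX
  omega

theorem superY_cases (hp : p < m) (hτ : τ < m) :
    superY m τ p < m ∧ (superY m τ p = p + 2 * τ ∨ superY m τ p + m = p + 2 * τ ∨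
      superY m τ p + 2 * m = p + 2 * τ) := by
  have h₁ := add_mod_cases hp hτ.le
  have h₂ := add_mod_cases (Nat.mod_lt (p + τ) (by omega : 0 < m)) hτ.le
  rw [Nat.mod_add_mod] at h₂
  rw [superY, show p + 2 * τ = p + τ + τ by ring]
  omega

theorem superX_lt (hp : p < m) (hτ : τ < m) : superX m τ p < m := (superX_cases hp hτ).1

theorem superY_lt (hp : p < m) (hτ : τ < m) : superY m τ p < m := (superY_cases hp hτ).1

theorem superX_inj (hp : p < m) (hp' : p' < m) (hτ : τ < m)
    (h : superX m τ p = superX m τ p') : p = p' := by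
  have := superX_cases hp hτ
  have := superX_cases hp' hτ
  omega

theorem superY_inj (hp : p < m) (hp' : p' < m) (hτ : τ < m)
    (h : superY m τ p = superY m τ p') : p = p' := by
  have := superY_cases hp hτ
  have := superY_cases hp' hτ
  omega

theorem superX_slot_inj (hp : p < m) (hτ : τ < m) (hτ' : τ' < m)
    (h : superX m τ p = superX m τ' p) : τ = τ' := by
  have := superX_cases hp hτ
  have := superX_cases hp hτ'
  omega

theorem superY_slot_inj (hm : Odd m) (hp : p < m) (hτ : τ < m) (hτ' : τ' < m)
    (h : superY m τ p = superY m τ' p) : τ = τ' := by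
  have := superY_cases hp hτ
  have := superY_cases hp hτ'
  rw [Nat.odd_iff] at hm
  omega

theorem super_pair_inj (hp : p < m) (hp' : p' < m) (hτ : τ < m) (hτ' : τ' < m)
    (hX : superX m τ p = superX m τ' p') (hY : superY m τ p = superY m τ' p') :
    τ = τ' ∧ p = p' := by
  have := superX_cases hp hτ
  have := superX_cases hp' hτ'
  have := superY_cases hp hτ
  have := superY_cases hp' hτ'
  omega

theorem exists_super_pair {i j : ℕ} (hi : i < m) (hj : j < m) :
    ∃ τ < m, ∃ p < m, superX m τ p = i ∧ superY m τ p = j := by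
  obtain ⟨τ, hτ, h⟩ : ∃ τ < m, i + τ = j ∨ i + τ = j + m := by
    rcases le_or_gt i j with h | h
    · exact ⟨j - i, by omega, by omega⟩
    · exact ⟨j + m - i, by omega, by omega⟩
  obtain ⟨p, hp, h'⟩ : ∃ p < m, p + τ = i ∨ p + τ = i + m := by
    rcases le_or_gt τ i with h | h
    · exact ⟨i - τ, by omega, by omega⟩
    · exact ⟨i + m - τ, by omega, by omega⟩
  have := superX_cases hp hτ
  have := superY_cases hp hτ
  exact ⟨τ, hτ, p, hp, by omega, by omega⟩

theorem exists_superX_eq {i : ℕ} (hp : p < m) (hi : i < m) : ∃ τ < m, superX m τ p = i := by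
  obtain ⟨τ, hτ, h⟩ : ∃ τ < m, p + τ = i ∨ p + τ = i + m := by
    rcases le_or_gt p i with h | h
    · exact ⟨i - p, by omega, by omega⟩
    · exact ⟨i + m - p, by omega, by omega⟩
  have := superX_cases hp hτ
  exact ⟨τ, hτ, by omega⟩

theorem exists_superY_eq (hm : Odd m) {j : ℕ} (hp : p < m) (hj : j < m) :
    ∃ τ < m, superY m τ p = j := by
  rw [Nat.odd_iff] at hm
  obtain ⟨τ, hτ, h⟩ : ∃ τ < m, p + 2 * τ = j ∨ p + 2 * τ = j + m ∨ p + 2 * τ = j + 2 * m := by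
    -- As $m$ is odd, $j-p$ or $j+m-p$ is even and can be halved.
    by_cases hpar : p % 2 = j % 2
    · rcases le_or_gt p j with h | h
      · exact ⟨(j - p) / 2, by omega, by omega⟩
      · exact ⟨(j + 2 * m - p) / 2, by omega, by omega⟩
    · exact ⟨(j + m - p) / 2, by omega, by omega⟩
  have := superY_cases hp hτ
  exact ⟨τ, hτ, by omega⟩

end Positions

/-! ### Labels of teams -/

section Labels

variable {d m p p' i i' k k' : ℕ}

theorem member_inj (hk : k < 3 * d) (hk' : k' < 3 * d) (h : member d i k = member d i' k') :
    i = i' ∧ k = k' := by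
  unfold member at h
  have h₁ := congrArg (· / (3 * d)) h
  have h₂ := congrArg (· % (3 * d)) h
  simp only [Nat.mul_add_mod, Nat.mod_eq_of_lt hk, Nat.mod_eq_of_lt hk'] at h₂
  simp only [Nat.mul_add_div (show 0 < 3 * d by omega), Nat.div_eq_of_lt hk,
    Nat.div_eq_of_lt hk'] at h₁
  exact ⟨h₁, h₂⟩

theorem member_lt (hi : i < m) (hk : k < 3 * d) : member d i k < 3 * m * d := by
  unfold member
  calc 3 * d * i + k < 3 * d * i + 3 * d := by omega
    _ = 3 * d * (i + 1) := by ring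
    _ ≤ 3 * d * m := Nat.mul_le_mul_left _ hi
    _ = 3 * m * d := by ring

theorem member_mod_three (d i k : ℕ) : member d i k % 3 = k % 3 := by
  rw [member, mul_assoc]
  omega

theorem exists_member_eq {a : ℕ} (ha : a < 3 * m * d) : ∃ i < m, ∃ k < 3 * d, a = member d i k := by
  have hd : 0 < 3 * d := by
    rcases Nat.eq_zero_or_pos d with rfl | h
    · simp at ha
    · omega
  refine ⟨a / (3 * d), ?_, a % (3 * d), Nat.mod_lt _ hd, (Nat.div_add_mod a (3 * d)).symm⟩
  rw [Nat.div_lt_iff_lt_mul hd]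
  calc a < 3 * m * d := ha
    _ = m * (3 * d) := by ring

theorem leftMember_self (d m p i : ℕ) : leftMember d m p i (3 * d) = 3 * m * d + p :=
  if_neg (lt_irrefl _)

theorem leftMember_cases (hi : i < m) (hk : k ≤ 3 * d) :
    (k < 3 * d ∧ leftMember d m p i k = member d i k ∧ leftMember d m p i k < 3 * m * d) ∨
      (k = 3 * d ∧ leftMember d m p i k = 3 * m * d + p) := by
  rcases hk.lt_or_eq with h | rfl
  · rw [leftMember_of_lt h]
    exact .inl ⟨h, rfl, member_lt hi h⟩
  · exact .inr ⟨rfl, leftMember_self ..⟩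

theorem leftMember_inj (hi : i < m) (hi' : i' < m) (hk : k ≤ 3 * d) (hk' : k' ≤ 3 * d)
    (h : leftMember d m p i k = leftMember d m p' i' k') :
    k = k' ∧ (k < 3 * d ∧ i = i' ∨ k = 3 * d ∧ p = p') := by
  rcases leftMember_cases (p := p) hi hk with ⟨h₁, h₂, h₃⟩ | ⟨h₁, h₂⟩ <;>
    rcases leftMember_cases (p := p') hi' hk' with ⟨h₄, h₅, h₆⟩ | ⟨h₄, h₅⟩
  · obtain ⟨rfl, rfl⟩ := member_inj h₁ h₄ (by rw [← h₂, h, h₅])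
    exact ⟨rfl, .inl ⟨h₁, rfl⟩⟩
  · omega
  · omega
  · exact ⟨by omega, .inr ⟨h₁, by omega⟩⟩

end Labels

/-! ### The venues at which a team plays -/

/-- A pattern of venues: on the days `t < T`, it alternates while `L t` holds, and has blocks of
three equal venues otherwise; from day `T` on it alternates, except between the days `T + l - 1`
and `T + l`. -/
def Pattern (L : ℕ → Prop) (T l c t : ℕ) : Prop :=
  if t < T then (L t ∧ t % 2 = 1 ∨ ¬ L t ∧ 3 ≤ (t + 6 - c) % 6)
  else if t - T < l then (t - T) % 2 = 1 else (t - T - l) % 2 = 0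

theorem pattern_of_lt {L : ℕ → Prop} {T l c t : ℕ} (ht : t < T) :
    Pattern L T l c t ↔ L t ∧ t % 2 = 1 ∨ ¬ L t ∧ 3 ≤ (t + 6 - c) % 6 := by
  rw [Pattern, if_pos ht]

theorem pattern_of_le {L : ℕ → Prop} {T l c t : ℕ} (ht : T ≤ t) :
    Pattern L T l c t ↔ if t - T < l then (t - T) % 2 = 1 else (t - T - l) % 2 = 0 := by
  rw [Pattern, if_neg (by omega)]

theorem pattern_last_succ {L : ℕ → Prop} {T l c t : ℕ} (ht : T ≤ t) (htl : t + 1 ≠ T + l) :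
    Pattern L T l c t ↔ ¬ Pattern L T l c (t + 1) := by
  obtain ⟨s, rfl⟩ := Nat.exists_eq_add_of_le ht
  rw [pattern_of_le ht, pattern_of_le (by omega), add_assoc, Nat.add_sub_cancel_left,
    Nat.add_sub_cancel_left]
  rcases lt_or_ge s l with h | h
  · rw [if_pos h, if_pos (by omega)]
    omega
  · rw [if_neg (by omega), if_neg (by omega)]
    omega

/-- Two successive days under `L`, or in the last slot away from its middle, have different venues.
Blocks of three are broken by the residue modulo 6, and `L` can change only where a new period of 6
begins; every period ends with the pattern true. -/
theorem pattern_not_const {L : ℕ → Prop} {T l c : ℕ} (hT : 6 ∣ T) (hl : 2 ≤ l) (hc : c < 3)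
    (hL : ∀ t, ¬ 6 ∣ t + 1 → (L t ↔ L (t + 1))) (P : Prop) (t : ℕ) :
    ¬ ∀ k < 4, (P ↔ Pattern L T l c (t + k)) := by
  intro H
  have h₀ := H 0 (by omega)
  have h₁ := H 1 (by omega)
  have h₂ := H 2 (by omega)
  have h₃ := H 3 (by omega)
  have l₀ := hL t
  have l₁ := hL (t + 1)
  have l₂ := hL (t + 2)
  simp only [add_assoc, Nat.reduceAdd, add_zero] at h₀ h₁ h₂ h₃ l₀ l₁ l₂
  obtain ⟨q, rfl⟩ := hT
  rcases le_or_gt (6 * q) (t + 2) with hqt | hqt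
  · rcases em (6 * q ≤ t + 1 ∧ t + 2 ≠ 6 * q + l) with hqt' | hqt'
    · have := pattern_last_succ (L := L) (l := l) (c := c) hqt'.1 hqt'.2
      rw [← h₁, ← h₂] at this
      exact iff_not_self this
    -- Day $t+2$ opens the last slot or its second half; by $2\le l$ the next day does not start a
    -- new half, so these two days differ.
    · have := pattern_last_succ (L := L) (l := l) (c := c) hqt (by omega)
      rw [← h₂, ← h₃] at this
      exact iff_not_self this
  rw [pattern_of_lt (by omega)] at h₀ h₁ h₂
  rcases le_or_gt (6 * q) (t + 3) with hqt' | hqt'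
  -- The pattern is false on the first day of the last slot, but true on the day before, which is 5
  -- modulo 6, whether `L` holds there or not.
  · rw [Pattern, if_neg (by omega), if_pos (by omega)] at h₃
    have hP : ¬ P := by rw [h₃]; omega
    rw [← l₁ (by omega)] at h₂
    clear H hL h₃ h₀ l₀ l₁ l₂
    by_cases L₁ : L (t + 1) <;>
      simp only [hP, L₁, true_and, false_and, false_iff, or_false, false_or, not_true,
        not_false_iff, not_le] at h₁ h₂ <;> omega
  · rw [pattern_of_lt (by omega)] at h₃
    clear H hL hqt hqt'
    generalize L t = L₀ at *
    generalize L (t + 1) = L₁ at *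
    generalize L (t + 2) = L₂ at *
    generalize L (t + 3) = L₃ at *
    by_cases hL₁ : L₁ <;> by_cases hL₂ : L₂
    · simp only [hL₁, hL₂, true_and, not_true, false_and, or_false] at h₁ h₂
      have := h₁.symm.trans h₂
      omega
    -- `L` changes just before day $t+2$, hence not just before day $t+1$: days $t$ and $t+1$
    -- alternate.
    · have e : (t + 2) % 6 = 0 := by
        by_contra hne
        exact hL₂ ((l₁ (by omega)).1 hL₁)
      replace l₀ := (l₀ (by omega)).2 hL₁
      simp only [hL₁, l₀, true_and, not_true, false_and, or_false] at h₀ h₁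
      have := h₀.symm.trans h₁
      omega
    · have e : (t + 2) % 6 = 0 := by
        by_contra hne
        exact hL₁ ((l₁ (by omega)).2 hL₂)
      replace l₂ := (l₂ (by omega)).1 hL₂
      simp only [hL₂, l₂, true_and, not_true, false_and, or_false] at h₂ h₃
      have := h₂.symm.trans h₃
      omega
    · simp only [hL₁, hL₂, false_and, not_false_iff, true_and, false_or, iff_false, iff_self,
        imp_true_iff, false_iff] at h₁ h₂ l₀ l₁ l₂
      by_cases hL₀ : L₀ <;> by_cases hL₃ : L₃ <;>
        simp only [hL₀, hL₃, false_and, not_false_iff, true_and, false_or, not_true,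
          or_false, imp_false, not_not, imp_true_iff] at h₀ h₃ l₀ l₂ <;>
      by_cases hP : P <;> simp only [hP, true_iff, false_iff] at h₀ h₁ h₂ h₃ <;> omega

/-- The conditions on the parameters of the construction under which the schedule is feasible. -/
structure Admissible (d m l : ℕ) : Prop where
  even : Even d
  pos : 0 < d
  odd : Odd m
  three_le : 3 ≤ m
  two_le : 2 ≤ l
  le : l ≤ m

/-! ### Days -/

theorem slot_day_lt {d m τ r : ℕ} (hτ : τ < m) (hr : r < 6 * d) :
    6 * d * τ + r < 6 * m * d :=
  calc 6 * d * τ + r < 6 * d * τ + 6 * d := by omega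
    _ = 6 * d * (τ + 1) := by ring
    _ ≤ 6 * d * m := Nat.mul_le_mul_left _ hτ
    _ = 6 * m * d := by ring

theorem labelDay_slot {d m l τ r : ℕ} (hτ : τ < m) (hr : r < 6 * d) :
    labelDay d m l (6 * d * τ + r) = slotDay d m l τ r := by
  rw [labelDay, if_pos (slot_day_lt hτ hr), Nat.mul_add_div (by omega), Nat.div_eq_of_lt hr, Nat.mul_add_mod,
    Nat.mod_eq_of_lt hr, add_zero]

theorem labelDay_last (d m l r : ℕ) : labelDay d m l (6 * m * d + r) = lastDay d m l r := by
  rw [labelDay, if_neg (by omega), Nat.add_sub_cancel_left]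

theorem exists_slot_day {d m t : ℕ} (ht : t < 6 * m * d) :
    ∃ τ < m, ∃ r < 6 * d, t = 6 * d * τ + r := by
  have hd : 0 < 6 * d := by
    rcases Nat.eq_zero_or_pos d with rfl | h
    · simp at ht
    · omega
  refine ⟨t / (6 * d), ?_, t % (6 * d), Nat.mod_lt _ hd, (Nat.div_add_mod t (6 * d)).symm⟩
  rw [Nat.div_lt_iff_lt_mul hd]
  calc t < 6 * m * d := ht
    _ = m * (6 * d) := by ring

variable {d m l : ℕ}

/-! ### Every game is played -/

theorem Admissible.exists_day_of_meets (H : Admissible d m l) {h : Bool} {τ p r e e' : ℕ}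
    (hτ : τ < m) (hp : p < m) (hr : r < 6 * d) (hM : Meets d l p r h e e') :
    ∃ t < 6 * m * d + 2 * l, fixture h (leftMember d m p (superX m τ p) e)
      (leftMember d m p (superY m τ p) e') ∈ labelDay d m l t := by
  refine ⟨6 * d * τ + r, by have := slot_day_lt hτ hr; omega, ?_⟩
  rw [labelDay_slot hτ hr]
  exact (mem_slotDay H.even hr).2 ⟨h, p, hp, e, e', hM, rfl⟩

theorem exists_last_day {c : ℕ} (hc : c < l) (h : Bool) :
    ∃ r < 2 * l, (h = true ↔ if r < l then Odd r else Even (r - l)) ∧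
      (if r < l then r else r - l) = c := by
  by_cases hh : h = true ↔ Odd c
  · exact ⟨c, by omega, by rwa [if_pos hc], if_pos hc⟩
  · refine ⟨l + c, by omega, ?_, by rw [if_neg (by omega)]; omega⟩
    rw [if_neg (by omega), Nat.add_sub_cancel_left, ← Nat.not_odd_iff_even]
    tauto

/-- Two super-teams determine slot and position; a super-team and a team-pair determine the slot,
the position being that of the pair. Only equal indices in a left super-game, and games between
team-pairs, are left for the last slot. -/
theorem Admissible.exists_day (H : Admissible d m l) (h : Bool) {a b : ℕ}
    (ha : a < 3 * m * d + l) (hb : b < 3 * m * d + l) :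
    ∃ t < 6 * m * d + 2 * l, fixture h a b ∈ labelDay d m l t := by
  have hlm := H.le
  rcases lt_or_ge a (3 * m * d) with ha' | ha' <;> rcases lt_or_ge b (3 * m * d) with hb' | hb'
  · obtain ⟨i, hi, k, hk, rfl⟩ := exists_member_eq ha'
    obtain ⟨j, hj, k', hk', rfl⟩ := exists_member_eq hb'
    obtain ⟨τ, hτ, p, hp, rfl, rfl⟩ := exists_super_pair hi hj
    rcases lt_or_ge p l with hpl | hpl
    · rcases eq_or_ne k k' with rfl | hne
      · obtain ⟨r, hr, hh, hrp⟩ := exists_last_day hpl h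
        refine ⟨6 * m * d + r, by omega, ?_⟩
        rw [labelDay_last, mem_lastDay]
        exact ⟨h, hh, .inr ⟨τ, hτ, k, hk, by rw [hrp]⟩⟩
      · obtain ⟨r, hr, hM⟩ := exists_meets_left H.even hpl hk.le hk'.le hne h
        have := H.exists_day_of_meets hτ hp hr hM
        rwa [leftMember_of_lt hk, leftMember_of_lt hk'] at this
    · obtain ⟨r, hr, hM⟩ := exists_meets_normal hpl hk hk' h
      have := H.exists_day_of_meets hτ hp hr hM
      rwa [leftMember_of_lt hk, leftMember_of_lt hk'] at this
  · obtain ⟨i, hi, k, hk, rfl⟩ := exists_member_eq ha'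
    obtain ⟨p, rfl⟩ := Nat.exists_eq_add_of_le hb'
    have hpl : p < l := by omega
    obtain ⟨τ, hτ, rfl⟩ := exists_superX_eq (hpl.trans_le hlm) hi
    obtain ⟨r, hr, hM⟩ := exists_meets_left H.even hpl hk.le le_rfl hk.ne h
    have := H.exists_day_of_meets hτ (hpl.trans_le hlm) hr hM
    rwa [leftMember_of_lt hk, leftMember_self] at this
  · obtain ⟨j, hj, k, hk, rfl⟩ := exists_member_eq hb'
    obtain ⟨p, rfl⟩ := Nat.exists_eq_add_of_le ha'
    have hpl : p < l := by omega
    obtain ⟨τ, hτ, rfl⟩ := exists_superY_eq H.odd (hpl.trans_le hlm) hj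
    obtain ⟨r, hr, hM⟩ := exists_meets_left H.even hpl le_rfl hk.le hk.ne' h
    have := H.exists_day_of_meets hτ (hpl.trans_le hlm) hr hM
    rwa [leftMember_of_lt hk, leftMember_self] at this
  · obtain ⟨p, rfl⟩ := Nat.exists_eq_add_of_le ha'
    obtain ⟨q, rfl⟩ := Nat.exists_eq_add_of_le hb'
    obtain ⟨c, hc, hcq⟩ : ∃ c < l, q = (p + c) % l := by
      rcases le_or_gt p q with hpq | hpq
      · exact ⟨q - p, by omega, by rw [Nat.mod_eq_of_lt (by omega)]; omega⟩
      · refine ⟨q + l - p, by omega, ?_⟩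
        rcases add_mod_cases (k := p) (c := q + l - p) (K := l) (by omega) (by omega) with h | h <;>
          omega
    obtain ⟨r, hr, hh, hrc⟩ := exists_last_day hc h
    refine ⟨6 * m * d + r, by omega, ?_⟩
    rw [labelDay_last, mem_lastDay]
    exact ⟨h, hh, .inl ⟨p, by omega, by rw [hrc, ← hcq]⟩⟩

/-! ### A team plays at most one game on a day -/

/-- What a game on a day of a time slot looks like. -/
theorem Admissible.of_mem_slot (H : Admissible d m l) {h : Bool} {a b τ r : ℕ} (hτ : τ < m)
    (hr : r < 6 * d) (hg : fixture h a b ∈ labelDay d m l (6 * d * τ + r)) :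
    ∃ p < m, ∃ e ≤ 3 * d, ∃ e' ≤ 3 * d, Meets d l p r h e e' ∧
      a = leftMember d m p (superX m τ p) e ∧ b = leftMember d m p (superY m τ p) e' := by
  rw [labelDay_slot hτ hr, mem_slotDay H.even hr] at hg
  obtain ⟨h', p, hp, e, e', hM, hg⟩ := hg
  obtain ⟨rfl, rfl, rfl⟩ := fixture_inj.1 hg
  have h₁ := hM.left_le H.pos
  have h₂ := hM.right_le H.pos
  exact ⟨p, hp, e, by omega, e', by omega, hM, rfl, rfl⟩

/-- What a game on a day of the last time slot looks like. -/
theorem of_mem_last {h : Bool} {a b r : ℕ} (hr : r < 2 * l)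
    (hg : fixture h a b ∈ labelDay d m l (6 * m * d + r)) :
    ∃ c < l, (r < l ∧ c = r ∨ l ≤ r ∧ c = r - l) ∧
      (h = true ↔ if r < l then r % 2 = 1 else (r - l) % 2 = 0) ∧
      ((∃ k < l, a = 3 * m * d + k ∧ b = 3 * m * d + (k + c) % l) ∨
      ∃ τ < m, ∃ k < 3 * d, a = member d (superX m τ c) k ∧ b = member d (superY m τ c) k) := by
  rw [labelDay_last, mem_lastDay] at hg
  obtain ⟨h', hh, hg⟩ := hg
  rw [Nat.odd_iff, Nat.even_iff] at hh
  refine ⟨if r < l then r else r - l, by split_ifs <;> omega, by split_ifs <;> omega, ?_⟩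
  rcases hg with ⟨k, hk, hg⟩ | ⟨τ, hτ, k, hk, hg⟩
  · obtain ⟨rfl, rfl, rfl⟩ := fixture_inj.1 hg
    exact ⟨hh, .inl ⟨k, hk, rfl, rfl⟩⟩
  · obtain ⟨rfl, rfl, rfl⟩ := fixture_inj.1 hg
    exact ⟨hh, .inr ⟨τ, hτ, k, hk, rfl, rfl⟩⟩

/-- In a fixed slot each super-team sits at one position, and a team-pair stays at its own position.
-/
theorem address_left_unique {τ p p' e e' : ℕ} (hτ : τ < m) (hp : p < m) (hp' : p' < m)
    (he : e ≤ 3 * d) (he' : e' ≤ 3 * d)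
    (h : leftMember d m p (superX m τ p) e = leftMember d m p' (superX m τ p') e') :
    p = p' ∧ e = e' := by
  obtain ⟨rfl, ⟨-, h⟩ | ⟨-, rfl⟩⟩ :=
    leftMember_inj (superX_lt hp hτ) (superX_lt hp' hτ) he he' h
  · exact ⟨superX_inj hp hp' hτ h, rfl⟩
  · exact ⟨rfl, rfl⟩

theorem address_right_unique {τ p p' e e' : ℕ} (hτ : τ < m) (hp : p < m) (hp' : p' < m)
    (he : e ≤ 3 * d) (he' : e' ≤ 3 * d)
    (h : leftMember d m p (superY m τ p) e = leftMember d m p' (superY m τ p') e') :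
    p = p' ∧ e = e' := by
  obtain ⟨rfl, ⟨-, h⟩ | ⟨-, rfl⟩⟩ :=
    leftMember_inj (superY_lt hp hτ) (superY_lt hp' hτ) he he' h
  · exact ⟨superY_inj hp hp' hτ h, rfl⟩
  · exact ⟨rfl, rfl⟩

theorem Admissible.right_unique (H : Admissible d m l) {h h' : Bool} {a b b' t : ℕ}
    (ht : t < 6 * m * d + 2 * l) (hg : fixture h a b ∈ labelDay d m l t)
    (hg' : fixture h' a b' ∈ labelDay d m l t) : h = h' ∧ b = b' := by
  rcases lt_or_ge t (6 * m * d) with ht' | ht'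
  · obtain ⟨τ, hτ, r, hr, rfl⟩ := exists_slot_day ht'
    obtain ⟨p, hp, e, he, f, hf, hM, rfl, rfl⟩ := H.of_mem_slot hτ hr hg
    obtain ⟨p', hp', e', he', f', hf', hM', h₁, rfl⟩ := H.of_mem_slot hτ hr hg'
    obtain ⟨rfl, rfl⟩ := address_left_unique hτ hp hp' he he' h₁
    obtain ⟨rfl, rfl⟩ := hM.right_unique hM' H.pos
    exact ⟨rfl, rfl⟩
  · obtain ⟨r, rfl⟩ := Nat.exists_eq_add_of_le ht'
    obtain ⟨c, hc, hcr, hh, hab⟩ := of_mem_last (by omega) hg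
    obtain ⟨c', hc', hcr', hh', hab'⟩ := of_mem_last (by omega) hg'
    obtain rfl : c = c' := by clear hab hab'; omega
    refine ⟨by rw [Bool.eq_iff_iff, hh, hh'], ?_⟩
    have hcm := hc.trans_le H.le
    rcases hab with ⟨k, hk, rfl, rfl⟩ | ⟨τ, hτ, k, hk, rfl, rfl⟩ <;>
      rcases hab' with ⟨k', hk', h₁, rfl⟩ | ⟨τ', hτ', k', hk', h₁, rfl⟩
    · rw [Nat.add_left_cancel h₁]
    · have := member_lt (superX_lt hcm hτ') hk'
      omega
    · have := member_lt (superX_lt hcm hτ) hk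
      omega
    · obtain ⟨h₂, rfl⟩ := member_inj hk hk' h₁
      rw [superX_slot_inj hcm hτ hτ' h₂]

theorem Admissible.left_unique (H : Admissible d m l) {h h' : Bool} {a a' b t : ℕ}
    (ht : t < 6 * m * d + 2 * l) (hg : fixture h a b ∈ labelDay d m l t)
    (hg' : fixture h' a' b ∈ labelDay d m l t) : h = h' ∧ a = a' := by
  rcases lt_or_ge t (6 * m * d) with ht' | ht'
  · obtain ⟨τ, hτ, r, hr, rfl⟩ := exists_slot_day ht'
    obtain ⟨p, hp, e, he, f, hf, hM, rfl, rfl⟩ := H.of_mem_slot hτ hr hg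
    obtain ⟨p', hp', e', he', f', hf', hM', rfl, h₁⟩ := H.of_mem_slot hτ hr hg'
    obtain ⟨rfl, rfl⟩ := address_right_unique hτ hp hp' hf hf' h₁
    obtain ⟨rfl, rfl⟩ := hM.left_unique hM' H.pos
    exact ⟨rfl, rfl⟩
  · obtain ⟨r, rfl⟩ := Nat.exists_eq_add_of_le ht'
    obtain ⟨c, hc, hcr, hh, hab⟩ := of_mem_last (by omega) hg
    obtain ⟨c', hc', hcr', hh', hab'⟩ := of_mem_last (by omega) hg'
    obtain rfl : c = c' := by clear hab hab'; omega
    refine ⟨by rw [Bool.eq_iff_iff, hh, hh'], ?_⟩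
    have hcm := hc.trans_le H.le
    rcases hab with ⟨k, hk, rfl, rfl⟩ | ⟨τ, hτ, k, hk, rfl, rfl⟩ <;>
      rcases hab' with ⟨k', hk', rfl, h₁⟩ | ⟨τ', hτ', k', hk', rfl, h₁⟩
    · have h₂ := add_mod_cases hk hc.le
      have h₃ := add_mod_cases hk' hc.le
      omega
    · have := member_lt (superY_lt hcm hτ') hk'
      omega
    · have := member_lt (superY_lt hcm hτ) hk
      omega
    · obtain ⟨h₂, rfl⟩ := member_inj hk hk' h₁
      rw [superY_slot_inj H.odd hcm hτ hτ' h₂]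

/-! ### No two teams meet on consecutive days -/

/-- Two super-teams, or a super-team and a team-pair, share a super-game in one slot only. Two teams
of team-pairs could only be partners of the same pair, which is shift $0$. -/
theorem Admissible.not_mem_next_slot (H : Admissible d m l) {h h' : Bool} {a b τ r r' : ℕ}
    (hτ : τ + 1 < m) (hr : r < 6 * d) (hr' : r' < 6 * d)
    (hg : fixture h a b ∈ labelDay d m l (6 * d * τ + r)) :
    fixture h' a b ∉ labelDay d m l (6 * d * (τ + 1) + r') := by
  intro hg'
  obtain ⟨p, hp, e, he, f, hf, hM, rfl, rfl⟩ := H.of_mem_slot (by omega) hr hg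
  obtain ⟨p', hp', e', he', f', hf', hM', h₁, h₂⟩ := H.of_mem_slot hτ hr' hg'
  have hτ' : τ < m := by omega
  have h₃ := (leftMember_inj (superX_lt hp hτ') (superX_lt hp' hτ) he he' h₁).2
  have h₄ := (leftMember_inj (superY_lt hp hτ') (superY_lt hp' hτ) hf hf' h₂).2
  rcases h₃ with ⟨-, h₃⟩ | ⟨he₁, rfl⟩ <;> rcases h₄ with ⟨-, h₄⟩ | ⟨hf₁, h₄⟩
  · have := super_pair_inj hp hp' hτ' hτ h₃ h₄
    omega
  · subst h₄
    have := superX_slot_inj hp hτ' hτ h₃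
    omega
  · have := superY_slot_inj H.odd hp hτ' hτ h₄
    omega
  · have := hM.left_le H.pos
    exact hM.ne (by omega) H.pos (by omega)

/-- The first day of the last slot has only games of shift $0$: partners of team-pairs, and equal
indices in left super-games at position $0$. No slot contains these (`Meets.ne`). -/
theorem Admissible.not_mem_last_of_mem_slot (H : Admissible d m l) {h h' : Bool} {a b τ r : ℕ}
    (hτ : τ + 1 = m) (hr : r < 6 * d)
    (hg : fixture h a b ∈ labelDay d m l (6 * d * τ + r)) :
    fixture h' a b ∉ labelDay d m l (6 * m * d + 0) := by
  intro hg'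
  have hl := H.two_le
  have hm := H.three_le
  have hτm : τ < m := by omega
  have hm0 : 0 < m := by omega
  obtain ⟨p, hp, e, he, f, hf, hM, rfl, rfl⟩ := H.of_mem_slot (by omega) hr hg
  obtain ⟨c, hc, hcr, -, hab⟩ := of_mem_last (by omega) hg'
  obtain rfl : c = 0 := by clear hab; omega
  have hX := leftMember_cases (p := p) (superX_lt hp hτm) he
  have hY := leftMember_cases (p := p) (superY_lt hp hτm) hf
  rcases hab with ⟨k, hk, h₁, h₂⟩ | ⟨τ', hτ', k, hk, h₁, h₂⟩
  · have := hM.left_le H.pos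
    exact hM.ne (by omega) H.pos (by omega)
  · have h₃ := member_lt (superX_lt hm0 hτ') hk
    have h₄ := member_lt (superY_lt hm0 hτ') hk
    rcases hX with ⟨he', hX, -⟩ | hX <;> [skip; omega]
    rcases hY with ⟨hf', hY, -⟩ | hY <;> [skip; omega]
    obtain ⟨h₅, h₆⟩ := member_inj he' hk (hX.symm.trans h₁)
    obtain ⟨h₇, h₈⟩ := member_inj hf' hk (hY.symm.trans h₂)
    obtain ⟨-, rfl⟩ := super_pair_inj hp hm0 hτm hτ' h₅ h₇
    exact hM.ne hc H.pos (h₆.trans h₈.symm)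

theorem Admissible.not_mem_succ (H : Admissible d m l) {h h' : Bool} {a b t : ℕ}
    (ht : t + 1 < 6 * m * d + 2 * l) (hg : fixture h a b ∈ labelDay d m l t) :
    fixture h' a b ∉ labelDay d m l (t + 1) := by
  have hl := H.two_le
  rcases lt_or_ge t (6 * m * d) with ht' | ht'
  · obtain ⟨τ, hτ, r, hr, rfl⟩ := exists_slot_day ht'
    rcases Nat.lt_or_ge (r + 1) (6 * d) with hr' | hr'
    · intro hg'
      obtain ⟨p, hp, e, he, f, hf, hM, rfl, rfl⟩ := H.of_mem_slot hτ hr hg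
      obtain ⟨p', hp', e', he', f', hf', hM', h₁, h₂⟩ := H.of_mem_slot hτ hr' hg'
      obtain ⟨rfl, rfl⟩ := address_left_unique hτ hp hp' he he' h₁
      obtain ⟨-, rfl⟩ := address_right_unique hτ hp hp hf hf' h₂
      exact hM.not_succ H.pos hr' hM'
    · rcases Nat.lt_or_ge (τ + 1) m with hτ' | hτ'
      · rw [show 6 * d * τ + r + 1 = 6 * d * (τ + 1) + 0 by rw [mul_add]; omega]
        exact H.not_mem_next_slot hτ' hr (by omega) hg
      · obtain rfl : m = τ + 1 := by omega
        rw [show 6 * d * τ + r + 1 = 6 * (τ + 1) * d + 0 by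
          rw [show 6 * (τ + 1) * d = 6 * d * τ + 6 * d by ring]; omega]
        exact H.not_mem_last_of_mem_slot rfl hr hg
  · obtain ⟨r, rfl⟩ := Nat.exists_eq_add_of_le ht'
    intro hg'
    obtain ⟨c, hc, hcr, -, hab⟩ := of_mem_last (by omega) hg
    obtain ⟨c', hc', hcr', -, hab'⟩ := of_mem_last (r := r + 1) (by omega) hg'
    -- At the middle of the last slot the index falls from $l-1$ to $0$; these differ because $2\le
    -- l$.
    have hne : c ≠ c' := by clear hab hab'; omega
    have hcm := hc.trans_le H.le
    have hcm' := hc'.trans_le H.le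
    rcases hab with ⟨k, hk, rfl, rfl⟩ | ⟨τ, hτ, k, hk, rfl, rfl⟩ <;>
      rcases hab' with ⟨k', hk', h₁, h₂⟩ | ⟨τ', hτ', k', hk', h₁, h₂⟩
    · have h₃ := add_mod_cases hk hc.le
      have h₄ := add_mod_cases hk' hc'.le
      omega
    · have := member_lt (superX_lt hcm' hτ') hk'
      omega
    · have := member_lt (superX_lt hcm hτ) hk
      omega
    · exact hne (super_pair_inj hcm hcm' hτ hτ' (member_inj hk hk' h₁).1
        (member_inj hk hk' h₂).1).2

/-! ### Bounds on home stands and road trips -/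

/-- The team of label `a` takes part in a left super-game in the time slot `τ`, where `F τ p` is
the super-team of its league at position `p`. -/
def InLeftGame (d m l : ℕ) (F : ℕ → ℕ → ℕ) (a τ : ℕ) : Prop :=
  ∃ p < l, ∃ e ≤ 3 * d, a = leftMember d m p (F τ p) e

theorem inLeftGame_congr (d m l : ℕ) (F : ℕ → ℕ → ℕ) (a : ℕ) {t : ℕ} (ht : ¬ 6 ∣ t + 1) :
    InLeftGame d m l F a (t / (6 * d)) ↔ InLeftGame d m l F a ((t + 1) / (6 * d)) := by
  rw [Nat.succ_div_of_not_dvd (fun h => ht (dvd_of_mul_right_dvd h))]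

theorem venue_of_mem_last {L : ℕ → Prop} {h : Bool} {a b c r : ℕ} (hr : r < 2 * l)
    (hg : fixture h a b ∈ labelDay d m l (6 * m * d + r)) :
    h = true ↔ Pattern L (6 * m * d) l c (6 * m * d + r) := by
  obtain ⟨-, -, -, hh, -⟩ := of_mem_last hr hg
  rwa [pattern_of_le (by omega), Nat.add_sub_cancel_left]

/-- Slots start at multiples of 6 and super-teams at labels divisible by 3, so day and index within
a super-game may be replaced by absolute day and label. -/
theorem venue_eq_of_slot {L : ℕ → Prop} {h : Bool} {i e p r τ : ℕ} (hτ : τ < m) (hr : r < 6 * d)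
    (hL : L (6 * d * τ + r) ↔ p < l) (he : e < 3 * d ∨ e = 3 * d ∧ p < l)
    (hh : h = true ↔ if p < l then r % 2 = 1 else 3 ≤ (r + 6 - e % 3) % 6) :
    h = true ↔ Pattern L (6 * m * d) l (leftMember d m p i e % 3) (6 * d * τ + r) := by
  rw [pattern_of_lt (slot_day_lt hτ hr), hh, hL]
  have h₁ : 6 * d * τ = 6 * (d * τ) := by ring
  rcases lt_or_ge p l with hp | hp
  · rw [if_pos hp]
    omega
  · rw [if_neg (by omega), leftMember_of_lt (by omega), member_mod_three]
    omega

theorem Admissible.venue_left (H : Admissible d m l) {h : Bool} {a b t : ℕ}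
    (ht : t < 6 * m * d + 2 * l) (hg : fixture h a b ∈ labelDay d m l t) :
    h = true ↔ Pattern (fun t => InLeftGame d m l (superX m) a (t / (6 * d))) (6 * m * d) l
      (a % 3) t := by
  rcases lt_or_ge t (6 * m * d) with ht' | ht'
  · obtain ⟨τ, hτ, r, hr, rfl⟩ := exists_slot_day ht'
    obtain ⟨p, hp, e, he, f, hf, hM, rfl, rfl⟩ := H.of_mem_slot hτ hr hg
    refine venue_eq_of_slot hτ hr ?_ (hM.left_le H.pos) (hM.venue_left H.pos)
    simp only [Nat.mul_add_div (show 0 < 6 * d by omega), Nat.div_eq_of_lt hr, add_zero]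
    refine ⟨?_, fun hpl => ⟨p, hpl, e, he, rfl⟩⟩
    rintro ⟨p', hpl', e', he', h₁⟩
    obtain ⟨rfl, -⟩ := address_left_unique hτ hp (hpl'.trans_le H.le) he he' h₁
    exact hpl'
  · obtain ⟨r, rfl⟩ := Nat.exists_eq_add_of_le ht'
    exact venue_of_mem_last (by omega) hg

theorem Admissible.venue_right (H : Admissible d m l) {h : Bool} {a b t : ℕ}
    (ht : t < 6 * m * d + 2 * l) (hg : fixture h a b ∈ labelDay d m l t) :
    h = true ↔ Pattern (fun t => InLeftGame d m l (superY m) b (t / (6 * d))) (6 * m * d) l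
      (b % 3) t := by
  rcases lt_or_ge t (6 * m * d) with ht' | ht'
  · obtain ⟨τ, hτ, r, hr, rfl⟩ := exists_slot_day ht'
    obtain ⟨p, hp, e, he, f, hf, hM, rfl, rfl⟩ := H.of_mem_slot hτ hr hg
    refine venue_eq_of_slot hτ hr ?_ (hM.right_le H.pos) (hM.venue_right H.pos)
    simp only [Nat.mul_add_div (show 0 < 6 * d by omega), Nat.div_eq_of_lt hr, add_zero]
    refine ⟨?_, fun hpl => ⟨p, hpl, f, hf, rfl⟩⟩
    rintro ⟨p', hpl', f', hf', h₁⟩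
    obtain ⟨rfl, -⟩ := address_right_unique hτ hp (hpl'.trans_le H.le) hf hf' h₁
    exact hpl'
  · obtain ⟨r, rfl⟩ := Nat.exists_eq_add_of_le ht'
    exact venue_of_mem_last (by omega) hg

theorem Admissible.not_four_left (H : Admissible d m l) (h : Bool) (a : ℕ) {t : ℕ}
    (ht : t + 3 < 6 * m * d + 2 * l) :
    ¬ ∀ k < 4, ∃ b, fixture h a b ∈ labelDay d m l (t + k) := fun hall =>
  pattern_not_const (L := fun t => InLeftGame d m l (superX m) a (t / (6 * d)))
    (T := 6 * m * d) (c := a % 3) ⟨m * d, by ring⟩ H.two_le (Nat.mod_lt _ (by omega))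
    (fun _ => inLeftGame_congr d m l _ a) (h = true) t fun k hk =>
      (hall k hk).elim fun _ hb => H.venue_left (by omega) hb

theorem Admissible.not_four_right (H : Admissible d m l) (h : Bool) (b : ℕ) {t : ℕ}
    (ht : t + 3 < 6 * m * d + 2 * l) :
    ¬ ∀ k < 4, ∃ a, fixture h a b ∈ labelDay d m l (t + k) := fun hall =>
  pattern_not_const (L := fun t => InLeftGame d m l (superY m) b (t / (6 * d)))
    (T := 6 * m * d) (c := b % 3) ⟨m * d, by ring⟩ H.two_le (Nat.mod_lt _ (by omega))
    (fun _ => inLeftGame_congr d m l _ b) (h = true) t fun k hk =>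
      (hall k hk).elim fun _ ha => H.venue_right (by omega) ha

/-! ### Counting -/

/-- If every element of `β` is related to some element of `α`, no two elements of `β` are related
to the same element of `α`, and `β` has as many elements as `α`, then the relation is a bijection. -/
theorem bijective_relation {α β : Type*} [Fintype α] [Fintype β]
    (hcard : Fintype.card β = Fintype.card α) (R : β → α → Prop) (hR : ∀ b, ∃ a, R b a)
    (hinj : ∀ b b' a, R b a → R b' a → b = b') :
    (∀ a, ∃ b, R b a) ∧ ∀ b a a', R b a → R b a' → a = a' := by
  choose f hf using hR
  have hf_inj : Function.Injective f := fun b b' h => hinj b b' _ (hf b) (h ▸ hf b')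
  have hf_surj := ((Fintype.bijective_iff_injective_and_card f).2 ⟨hf_inj, hcard⟩).2
  have key : ∀ b a, R b a → f b = a := by
    intro b a h
    obtain ⟨b', rfl⟩ := hf_surj a
    rw [hinj b b' _ h (hf b')]
  exact ⟨fun a => (hf_surj a).elim fun b h => ⟨b, h ▸ hf b⟩,
    fun b a a' h h' => (key b a h).symm.trans (key b a' h')⟩

/-! ### Labels of a packing -/

namespace LabelledPacking

variable {V : Type*} {N l : ℕ} (P : LabelledPacking V N l)

theorem label_path (i : Fin N) (c : Fin 3) : P.label (P.path i c) = 3 * i.val + c.val := by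
  have h : (Equiv.ofBijective _ P.bijective).symm (P.path i c) = Sum.inl (i, c) :=
    (Equiv.symm_apply_eq _).2 rfl
  rw [label, h]

theorem label_rest (j : Fin l) : P.label (P.rest j) = 3 * N + j.val := by
  have h : (Equiv.ofBijective _ P.bijective).symm (P.rest j) = Sum.inr j :=
    (Equiv.symm_apply_eq _).2 rfl
  rw [label, h]

theorem exists_eq (v : V) : (∃ i c, v = P.path i c) ∨ ∃ j, v = P.rest j := by
  obtain ⟨q | j, rfl⟩ := P.bijective.2 v
  · exact .inl ⟨q.1, q.2, rfl⟩
  · exact .inr ⟨j, rfl⟩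

theorem label_lt (v : V) : P.label v < 3 * N + l := by
  rcases P.exists_eq v with ⟨i, c, rfl⟩ | ⟨j, rfl⟩
  · rw [label_path]; omega
  · rw [label_rest]; omega

theorem label_injective : Function.Injective P.label := by
  intro v w h
  rcases P.exists_eq v with ⟨i, c, rfl⟩ | ⟨j, rfl⟩ <;>
    rcases P.exists_eq w with ⟨i', c', rfl⟩ | ⟨j', rfl⟩ <;>
    simp only [label_path, label_rest] at h
  · obtain rfl : i = i' := by ext; omega
    obtain rfl : c = c' := by ext; omega
    rfl
  · omega
  · omega
  · obtain rfl : j = j' := by ext; omega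
    rfl

end LabelledPacking

/-! ### Feasibility -/

/-- The schedule on labels is feasible for teams that are labelled injectively. -/
theorem Admissible.isFeasible {d m l n : ℕ} (H : Admissible d m l) (hn : n = 3 * m * d + l)
    {X Y : Type*} [Fintype X] [Fintype Y] (hX : Fintype.card X = n) (hY : Fintype.card Y = n)
    {f : X → ℕ} {f' : Y → ℕ} (hf : Function.Injective f) (hf' : Function.Injective f')
    (hfn : ∀ x, f x < n) (hfn' : ∀ y, f' y < n) :
    IsFeasible (n := n) fun t => {g | g.map f f' ∈ labelDay d m l t.val} := by
  have hD : 2 * n = 6 * m * d + 2 * l := by rw [hn]; ring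
  have hlt : ∀ t : Fin (2 * n), t.val < 6 * m * d + 2 * l := fun t => hD ▸ t.isLt
  have hfix : ∀ {t} {g : Game X Y}, g.map f f' ∈ labelDay d m l t → ∃ h x y, g = fixture h x y := by
    intro t g hg
    obtain ⟨h, a, b, h'⟩ := exists_fixture_of_mem_labelDay H.even H.pos hg
    obtain ⟨x, y, rfl⟩ := exists_fixture_of_map h'
    exact ⟨h, x, y, rfl⟩
  let R : Bool → X → Y → Fin (2 * n) → Prop :=
    fun h x y t => fixture h (f x) (f' y) ∈ labelDay d m l t.val
  have hmem : ∀ {h : Bool} {x : X} {y : Y} {t : Fin (2 * n)},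
      (fixture h x y).map f f' ∈ labelDay d m l t.val ↔ R h x y t := by
    intros; rw [fixture_map]
  have hday : ∀ h x y, ∃ t, R h x y t := by
    intro h x y
    obtain ⟨t, ht, hg⟩ := H.exists_day h (hn ▸ hfn x) (hn ▸ hfn' y)
    exact ⟨⟨t, by omega⟩, hg⟩
  have hYu : ∀ {h h' x y y' t}, R h x y t → R h' x y' t → h = h' ∧ y = y' := by
    intro h h' x y y' t h₁ h₂
    obtain ⟨h₃, h₄⟩ := H.right_unique (hlt t) h₁ h₂
    exact ⟨h₃, hf' h₄⟩
  have hXu : ∀ {h h' x x' y t}, R h x y t → R h' x' y t → h = h' ∧ x = x' := by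
    intro h h' x x' y t h₁ h₂
    obtain ⟨h₃, h₄⟩ := H.left_unique (hlt t) h₁ h₂
    exact ⟨h₃, hf h₄⟩
  -- For a fixed team, the $2n$ pairs (venue, opponent) are matched with the $2n$ days.
  have hbX := fun x => bijective_relation (α := Fin (2 * n)) (β := Bool × Y) (by simp [hY])
    (fun q t => R q.1 x q.2 t) (fun q => hday q.1 x q.2)
    (fun q q' t h₁ h₂ => Prod.ext (hYu h₁ h₂).1 (hYu h₁ h₂).2)
  have hbY := fun y => bijective_relation (α := Fin (2 * n)) (β := Bool × X) (by simp [hX])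
    (fun q t => R q.1 q.2 y t) (fun q => hday q.1 q.2 y)
    (fun q q' t h₁ h₂ => Prod.ext (hXu h₁ h₂).1 (hXu h₁ h₂).2)
  have honce : ∀ h x y, ∃! t : Fin (2 * n), (fixture h x y).map f f' ∈ labelDay d m l t.val := by
    intro h x y
    simp only [hmem]
    obtain ⟨t, ht⟩ := hday h x y
    exact ⟨t, ht, fun t' ht' => (hbX x).2 (h, y) t' t ht' ht⟩
  -- Treats hosts and visitors at once: `s` selects the team of `X` at venue `b` and the team of `Y`
  -- at the other venue.
  have hbound : ∀ (b : Bool) (t : ℕ) (ht : t + 3 < 2 * n) (v : X ⊕ Y)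
      (s : Game X Y → X ⊕ Y), (∀ h x y, s (fixture h x y) =
        if h = b then Sum.inl x else Sum.inr y) →
      ¬ ∀ k : Fin 4, ∃ g : Game X Y, g.map f f' ∈ labelDay d m l (t + k.val) ∧ s g = v := by
    intro b t ht v s hs hall
    rcases v with x | y
    · refine H.not_four_left b (f x) (t := t) (by omega) fun k hk => ?_
      obtain ⟨g, hg, hv⟩ := hall ⟨k, hk⟩
      obtain ⟨h, x', y', rfl⟩ := hfix hg
      rw [hs] at hv
      split_ifs at hv with hb
      obtain rfl := Sum.inl_injective hv
      subst hb
      rw [fixture_map] at hg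
      exact ⟨_, hg⟩
    · refine H.not_four_right (!b) (f' y) (t := t) (by omega) fun k hk => ?_
      obtain ⟨g, hg, hv⟩ := hall ⟨k, hk⟩
      obtain ⟨h, x', y', rfl⟩ := hfix hg
      rw [hs] at hv
      split_ifs at hv with hb
      obtain rfl := Sum.inr_injective hv
      obtain rfl : h = !b := Bool.eq_not.2 hb
      rw [fixture_map] at hg
      exact ⟨_, hg⟩
  refine ⟨?_, fun x y => honce false x y, fun x y => honce true x y, ?_, ?_, ?_, ?_⟩
  · intro t g hg
    obtain ⟨h, x, y, rfl⟩ := hfix hg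
    cases h <;> simp [fixture]
  · rintro t (x | y)
    · obtain ⟨⟨h, y⟩, hg⟩ := (hbX x).1 t
      refine ⟨fixture h x y, ⟨hmem.2 hg, involves_inl.2 rfl⟩, ?_⟩
      rintro g ⟨hg', hv⟩
      obtain ⟨h', x', y', rfl⟩ := hfix hg'
      obtain rfl := involves_inl.1 hv
      obtain ⟨rfl, rfl⟩ := hYu hg (hmem.1 hg')
      rfl
    · obtain ⟨⟨h, x⟩, hg⟩ := (hbY y).1 t
      refine ⟨fixture h x y, ⟨hmem.2 hg, involves_inr.2 rfl⟩, ?_⟩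
      rintro g ⟨hg', hv⟩
      obtain ⟨h', x', y', rfl⟩ := hfix hg'
      obtain rfl := involves_inr.1 hv
      obtain ⟨rfl, rfl⟩ := hXu hg (hmem.1 hg')
      rfl
  · intro t t' htt' g hg g' hg'
    obtain ⟨h, x, y, rfl⟩ := hfix hg
    have key : ∀ h', fixture h' x y ≠ g' := by
      rintro h' rfl
      have hlt' := hlt t'
      rw [← htt'] at hlt'
      refine H.not_mem_succ hlt' (hmem.1 hg) (h' := h') ?_
      rw [htt']
      exact hmem.1 hg'
    exact ⟨(key h).symm, by rw [fixture_rev]; exact (key _).symm⟩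
  · intro v t ht
    exact hbound true t ht v Game.host (fun h x y => by cases h <;> simp [fixture])
  · intro v t ht
    exact hbound false t ht v Game.visitor (fun h x y => by cases h <;> simp [fixture])

/-! ### Parameters of the construction -/

/-- With $m=2q+1$ and $q+1=\lfloor n/(6d)\rfloor$ one has $3md=6dq+3d$, so $l=3d+(n \bmod 6d)<9d$,
while $m\ge 36d-1$. -/
theorem admissible_of_le {n d : ℕ} (hd : Even d) (hd0 : 0 < d) (hn : 108 * d ^ 3 ≤ n) :
    Admissible d (numSuper n d) (numPairs n d) ∧
      n = 3 * numSuper n d * d + numPairs n d := by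
  have hr := Nat.mod_lt n (show 0 < 6 * d by omega)
  have hdiv := Nat.div_add_mod n (6 * d)
  have hq : 18 * d ≤ n / (6 * d) := by
    rw [Nat.le_div_iff_mul_le (by omega)]
    -- $18d\cdot 6d=108d^2\le 108d^3\le n$.
    nlinarith [Nat.pow_le_pow_right hd0 (show 2 ≤ 3 by norm_num)]
  obtain ⟨q, hq'⟩ := Nat.exists_eq_add_of_lt (show 0 < n / (6 * d) by omega)
  have hm : numSuper n d = 2 * q + 1 := by rw [numSuper, hq']; omega
  have hn' : n = 3 * numSuper n d * d + (3 * d + n % (6 * d)) := by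
    rw [hm]
    conv_lhs => rw [← hdiv, hq']
    ring
  have hl : numPairs n d = 3 * d + n % (6 * d) := by
    unfold numPairs
    omega
  refine ⟨⟨hd, hd0, hm ▸ ⟨q, rfl⟩, by omega, by omega, by omega⟩, by rw [hl]; exact hn'⟩

theorem pathsPerTeam_even (ε : ℝ) : Even (pathsPerTeam ε) :=
  Nat.even_mul.2 (.inl (by decide))

theorem pathsPerTeam_pos {ε : ℝ} (hε : 0 < ε) : 0 < pathsPerTeam ε :=
  Nat.mul_pos (by norm_num) (Nat.ceil_pos.2 (one_div_pos.2 hε))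

end BTTP

theorem theorem1 (ε : ℝ) (hε : 0 < ε) (n d : ℕ) (hd : d = BTTP.pathsPerTeam ε)
    (hn : 108 * d ^ 3 ≤ n)
    {X Y : Type*} [Fintype X] [Fintype Y] (hX : Fintype.card X = n) (hY : Fintype.card Y = n)
    (P : BTTP.LabelledPacking X (BTTP.numSuper n d * d) (BTTP.numPairs n d))
    (Q : BTTP.LabelledPacking Y (BTTP.numSuper n d * d) (BTTP.numPairs n d)) :
    BTTP.IsFeasible (BTTP.threePathSchedule n d P Q) := by
  obtain ⟨H, hn'⟩ := BTTP.admissible_of_le (hd ▸ BTTP.pathsPerTeam_even ε)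
    (hd ▸ BTTP.pathsPerTeam_pos hε) hn
  rw [mul_assoc] at hn'
  exact H.isFeasible (by rw [mul_assoc]; exact hn') hX hY P.label_injective Q.label_injective
    (fun x => (P.label_lt x).trans_eq hn'.symm) (fun y => (Q.label_lt y).trans_eq hn'.symm)
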